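/- Let $d,q\in\mathbb N$ and let $X\subset\mathbb R^d$ be compact. For a multi-index $k=(k_1,\dots,k_d)\in\mathbb Z_+^d$ put $|k|=k_1+\dots+k_d$ and $D^k=\partial_1^{k_1}\cdots\partial_d^{k_d}$, and write $k\le m$ if $k_j\le m_j$ for all $j$. For $m\in\mathbb Z_+^d$ let $\hat C^m(X)$ be the set of real-valued functions $f$ for which there is an open set $U\supseteq X$ such that $f$ is defined on $U$ and, for every $k\le m$, $D^kf$ exists and is continuous on $U$. Let $m_1,\dots,m_q\in\mathbb Z_+^d$ and let $f\in\hat C^{m_1}(X)\cap\cdots\cap\hat C^{m_q}(X)$ satisfy $f(x)\ge 0$ for all $x\in X$. Let $\sigma\in C^r(\mathbb R)$, where $r=\max_{1\le i\le q}|m_i|$ (with $r=0$ if $q=0$), be a real-valued function that is not a polynomial. Then for every $\epsilon>0$ there are $N\in\mathbb N$, $a_j,\theta_j\in\mathbb R$ and $y_j\in\mathbb R^d$ ($1\le j\le N$) such that the one-hidden-layer neural network $$G(x)=\sum_{j=1}^N a_j\,\sigma(y_j^{T}x+\theta_j),\qquad x\in\mathbb R^d,$$ satisfies $G(x)\ge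 0$ for all $x\in X$ and $$\sup_{x\in X}|D^kf(x)-D^kG(x)|<\epsilon$$ for every multi-index $k$ such that $k\le m_i$ for some $i\in\{1,\dots,q\}$ (the supremum being $0$ if $X=\emptyset$). -/

import Mathlib

open scoped ENNReal

noncomputable section

/-- The partial derivative `∂ᵢ g` on `ℝᵈ`. -/
def partialDeriv {d : ℕ} (i : Fin d) (g : (Fin d → ℝ) → ℝ) : (Fin d → ℝ) → ℝ :=
  fun x => lineDeriv ℝ g x (Pi.single i 1)

/-- The multi-index derivative `D^k g = ∂₁^{k₁} ∂₂^{k₂} ⋯ ∂_d^{k_d} g`, where the derivatives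
in the last coordinate are taken first. -/
def multiDeriv {d : ℕ} (k : Fin d → ℕ) (g : (Fin d → ℝ) → ℝ) : (Fin d → ℝ) → ℝ :=
  (List.finRange d).foldr (fun i h => (partialDeriv i)^[k i] h) g

/-- `g ∈ C^m(U)` for a multi-index `m`: for every multi-index `k ≤ m` the derivative `D^k g`
exists on `U` and is continuous there.  If `k j = 0` for all `j < i`, then `∂ᵢ (D^k g)` is
`D^{k + eᵢ} g`; so `exists_deriv` says that every single differentiation in the formation of the
`D^k g`, `k ≤ m`, is that of a function which has the partial derivative in question. -/
structure IsCmOn {d : ℕ} (m : Fin d → ℕ) (U : Set (Fin d → ℝ)) (g : (Fin d → ℝ) → ℝ) :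
    Prop where
  exists_deriv : ∀ k : Fin d → ℕ, k ≤ m → ∀ i : Fin d, k i < m i → (∀ j < i, k j = 0) →
    ∀ x ∈ U, LineDifferentiableAt ℝ (multiDeriv k g) x (Pi.single i 1)
  continuousOn : ∀ k : Fin d → ℕ, k ≤ m → ContinuousOn (multiDeriv k g) U

/-- `g ∈ Ĉ^m(X)`: `g` is of class `C^m` on some open set that contains `X`.
(The values of `g` outside that open set are irrelevant.) -/
def IsCHat {d : ℕ} (m : Fin d → ℕ) (X : Set (Fin d → ℝ)) (g : (Fin d → ℝ) → ℝ) : Prop :=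
  ∃ U : Set (Fin d → ℝ), IsOpen U ∧ X ⊆ U ∧ IsCmOn m U g

/-- The one-hidden-layer network `G(x) = ∑ⱼ aⱼ σ(yⱼᵀ x + θⱼ)`. -/
def network {d N : ℕ} (σ : ℝ → ℝ) (a θ : Fin N → ℝ) (y : Fin N → Fin d → ℝ) :
    (Fin d → ℝ) → ℝ :=
  fun x => ∑ j, a j * σ (y j ⬝ᵥ x + θ j)

/-- The uniform norm of `g` on `X`, with values in `[0, ∞]`. -/
def supNormOn {d : ℕ} (X : Set (Fin d → ℝ)) (g : (Fin d → ℝ) → ℝ) : ℝ≥0∞ :=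
  ⨆ x ∈ X, ‖g x‖ₑ

end

open MeasureTheory Filter Topology

/-! Only finitely many multi-indices `k` lie below some `m i`. Attach to each `C^r` function `g` its
jet, the family of all these `D^k g` restricted to `X`, in a finite product of copies of `C(X, ℝ)`.
The question is which jets lie in the closed span `networkJets` of the jets of the functions `x ↦ σ
(y ⬝ᵥ x + θ)`. This span is enlarged in four stages.

(1) Regularization. Let `ρ` be the convolution of `σ` with a test function. The jet of `ρ (y ⬝ᵥ x +
θ)` is an integral of jets of translates, hence stays in the closed span
(`jet_ridge_regularization_mem`). As `σ` is not a polynomial, for each `n` some `ρ` has a nonzero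
`n`-th derivative at some `θ`: otherwise all regularizations would be polynomials of degree `< n`,
and so would their limit `σ`.

(2) Powers of linear forms. Expand `ρ (c (y ⬝ᵥ x) + θ)` in powers of `c`, remove the lower terms by
induction, divide by the coefficient of order `n` and let `c → 0` (`jet_ridge_pow_mem`). Powers of
linear forms span all polynomials, by polarization.

(3) Products of smooth functions of one coordinate each, by Weierstrass approximation of every
factor together with its derivatives (`jet_prodFun_mem`).

(4) The function `f`. Integrating `f` against translates of a product kernel gives an element of the
closed span; integration by parts turns its `k`-th component into an average of `D^k f` near `x`,
which is uniformly close to `D^k f` on `X` (`exists_mem_networkJets_near`). Only derivatives in the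
prescribed order are used, so `f` need not be `C^r`.

For nonnegativity, `f + ε/3` is approximated within `ε/3` in place of `f`. -/

/-- Induction on multi-indices in which a unit vector `eᵢ` is added only when all the entries
before the `i`-th vanish. -/
theorem multiIndex_induction {d : ℕ} {P : (Fin d → ℕ) → Prop} (zero : P 0)
    (step : ∀ (k : Fin d → ℕ) (i : Fin d), (∀ j < i, k j = 0) → P k → P (k + Pi.single i 1))
    (k : Fin d → ℕ) : P k := by
  induction hn : ∑ j, k j generalizing k with
  | zero =>
    have : k = 0 := by
      funext j
      exact (Finset.sum_eq_zero_iff.1 hn) j (Finset.mem_univ j)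
    exact this ▸ zero
  | succ n ih =>
    have hne : (Finset.univ.filter fun j => k j ≠ 0).Nonempty := by
      by_contra h
      rw [Finset.not_nonempty_iff_eq_empty, Finset.filter_eq_empty_iff] at h
      have : ∑ j, k j = 0 := Finset.sum_eq_zero fun j hj => not_not.1 (h hj)
      omega
    set i := (Finset.univ.filter fun j => k j ≠ 0).min' hne with hi
    have hki : k i ≠ 0 := (Finset.mem_filter.1 (Finset.min'_mem _ hne)).2
    have hlt : ∀ j < i, k j = 0 := by
      intro j hj
      by_contra h
      exact absurd (Finset.min'_le _ j (Finset.mem_filter.2 ⟨Finset.mem_univ j, h⟩))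
        (not_le.2 hj)
    have hk : (k - Pi.single i 1) + Pi.single i 1 = k := by
      refine tsub_add_cancel_of_le fun j => ?_
      rcases eq_or_ne j i with rfl | hj
      · simpa using Nat.one_le_iff_ne_zero.2 hki
      · simp [hj]
    rw [← hk]
    refine step _ i (fun j hj => by simp [hlt j hj]) (ih _ ?_)
    have : ∑ j, ((k - Pi.single i 1) + Pi.single i 1 : Fin d → ℕ) j = n + 1 := by rw [hk, hn]
    simpa [Finset.sum_add_distrib] using this

/-! ### Calculus of multi-index derivatives -/

theorem multiDeriv_zero {d : ℕ} (g : (Fin d → ℝ) → ℝ) : multiDeriv 0 g = g := by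
  unfold multiDeriv
  induction List.finRange d with
  | nil => rfl
  | cons a l ih => simp

/-- Derivatives in lower coordinates are applied last. If there are none, the additional `∂ᵢ` is
outermost, so partial derivatives never have to be commuted. -/
theorem multiDeriv_add_single {d : ℕ} (k : Fin d → ℕ) (i : Fin d) (hk : ∀ j < i, k j = 0)
    (g : (Fin d → ℝ) → ℝ) :
    multiDeriv (k + Pi.single i 1) g = partialDeriv i (multiDeriv k g) := by
  -- In a sorted list containing `i`, the entries in front of `i` contribute no derivative, so the
  -- extra `∂ᵢ` passes to the front.
  have key : ∀ l : List (Fin d), l.Pairwise (· < ·) →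
      (i ∉ l → l.foldr (fun j h => (partialDeriv j)^[(k + Pi.single i 1 : Fin d → ℕ) j] h) g =
        l.foldr (fun j h => (partialDeriv j)^[k j] h) g) ∧
      (i ∈ l → l.foldr (fun j h => (partialDeriv j)^[(k + Pi.single i 1 : Fin d → ℕ) j] h) g =
        partialDeriv i (l.foldr (fun j h => (partialDeriv j)^[k j] h) g)) := by
    intro l hl
    induction l with
    | nil => simp
    | cons a l ih =>
      obtain ⟨hal, hl'⟩ := List.pairwise_cons.1 hl
      obtain ⟨ih1, ih2⟩ := ih hl'
      constructor
      · intro hi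
        rw [List.mem_cons, not_or] at hi
        rw [List.foldr_cons, List.foldr_cons, ih1 hi.2]
        simp [Ne.symm hi.1]
      · intro hi
        rw [List.foldr_cons, List.foldr_cons]
        rcases eq_or_ne i a with rfl | hne
        · rw [ih1 fun h => lt_irrefl _ (hal _ h)]
          simp [Function.iterate_succ_apply']
        · have hil : i ∈ l := (List.mem_cons.1 hi).resolve_left hne
          rw [ih2 hil]
          simp [hk a (hal i hil), hne.symm]
  exact (key _ (List.pairwise_lt_finRange d)).2 (List.mem_finRange i)

theorem sum_add_single {d : ℕ} (k : Fin d → ℕ) (i : Fin d) :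
    ∑ j, (k + Pi.single i 1 : Fin d → ℕ) j = ∑ j, k j + 1 := by
  simp [Finset.sum_add_distrib]

theorem contDiff_partialDeriv {d n : ℕ} {g : (Fin d → ℝ) → ℝ}
    (hg : ContDiff ℝ ((n + 1 : ℕ) : WithTop ℕ∞) g) (i : Fin d) :
    ContDiff ℝ n (partialDeriv i g) := by
  have h : partialDeriv i g = fun x => fderiv ℝ g x (Pi.single i 1) := by
    funext x
    exact ((hg.differentiable (by simp)) x).lineDeriv_eq_fderiv
  rw [h]
  exact (hg.fderiv_right (m := n) (by simp)).clm_apply contDiff_const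

theorem contDiff_multiDeriv {d r : ℕ} {g : (Fin d → ℝ) → ℝ} (hg : ContDiff ℝ r g)
    (k : Fin d → ℕ) : ∀ n : ℕ, ∑ j, k j + n ≤ r → ContDiff ℝ n (multiDeriv k g) := by
  induction k using multiIndex_induction with
  | zero =>
    intro n hn
    rw [multiDeriv_zero]
    exact hg.of_le (by exact_mod_cast (by simpa using hn))
  | step k i hk ih =>
    intro n hn
    rw [sum_add_single] at hn
    rw [multiDeriv_add_single k i hk]
    exact contDiff_partialDeriv (ih (n + 1) (by omega)) i

theorem continuous_multiDeriv {d r : ℕ} {g : (Fin d → ℝ) → ℝ} (hg : ContDiff ℝ r g)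
    {k : Fin d → ℕ} (hk : ∑ j, k j ≤ r) : Continuous (multiDeriv k g) :=
  (contDiff_multiDeriv hg k 0 (by simpa using hk)).continuous

theorem differentiable_multiDeriv {d r : ℕ} {g : (Fin d → ℝ) → ℝ} (hg : ContDiff ℝ r g)
    {k : Fin d → ℕ} (hk : ∑ j, k j + 1 ≤ r) : Differentiable ℝ (multiDeriv k g) :=
  (contDiff_multiDeriv hg k 1 hk).differentiable (by simp)

theorem partialDeriv_add {d : ℕ} (i : Fin d) {g h : (Fin d → ℝ) → ℝ}
    (hg : Differentiable ℝ g) (hh : Differentiable ℝ h) :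
    partialDeriv i (g + h) = partialDeriv i g + partialDeriv i h := by
  funext x
  exact HasDerivAt.deriv (HasDerivAt.add (hg x).lineDifferentiableAt.hasLineDerivAt
    (hh x).lineDifferentiableAt.hasLineDerivAt)

theorem partialDeriv_smul {d : ℕ} (i : Fin d) (c : ℝ) {g : (Fin d → ℝ) → ℝ}
    (hg : Differentiable ℝ g) : partialDeriv i (c • g) = c • partialDeriv i g := by
  funext x
  exact HasDerivAt.deriv
    (HasDerivAt.const_smul c (hg x).lineDifferentiableAt.hasLineDerivAt)

theorem multiDeriv_add {d r : ℕ} {g h : (Fin d → ℝ) → ℝ} (hg : ContDiff ℝ r g)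
    (hh : ContDiff ℝ r h) (k : Fin d → ℕ) (hk : ∑ j, k j ≤ r) :
    multiDeriv k (g + h) = multiDeriv k g + multiDeriv k h := by
  induction k using multiIndex_induction with
  | zero => simp [multiDeriv_zero]
  | step k i hki ih =>
    rw [sum_add_single] at hk
    rw [multiDeriv_add_single k i hki, multiDeriv_add_single k i hki,
      multiDeriv_add_single k i hki, ih (by omega),
      partialDeriv_add i (differentiable_multiDeriv hg hk) (differentiable_multiDeriv hh hk)]

theorem multiDeriv_smul {d r : ℕ} (c : ℝ) {g : (Fin d → ℝ) → ℝ} (hg : ContDiff ℝ r g)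
    (k : Fin d → ℕ) (hk : ∑ j, k j ≤ r) : multiDeriv k (c • g) = c • multiDeriv k g := by
  induction k using multiIndex_induction with
  | zero => simp [multiDeriv_zero]
  | step k i hki ih =>
    rw [sum_add_single] at hk
    rw [multiDeriv_add_single k i hki, multiDeriv_add_single k i hki, ih (by omega),
      partialDeriv_smul i c (differentiable_multiDeriv hg hk)]

/-- The multi-index derivatives of a ridge function. -/
theorem multiDeriv_ridge {d r : ℕ} {ρ : ℝ → ℝ} (hρ : ContDiff ℝ r ρ) (y : Fin d → ℝ) (θ : ℝ)
    (k : Fin d → ℕ) (hk : ∑ j, k j ≤ r) :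
    multiDeriv k (fun x => ρ (y ⬝ᵥ x + θ)) =
      fun x => (∏ j, y j ^ k j) * iteratedDeriv (∑ j, k j) ρ (y ⬝ᵥ x + θ) := by
  induction k using multiIndex_induction with
  | zero => simp [multiDeriv_zero]
  | step k i hki ih =>
    rw [sum_add_single] at hk ⊢
    rw [multiDeriv_add_single k i hki, ih (by omega)]
    funext x
    refine HasLineDerivAt.lineDeriv ?_
    have h1 : HasDerivAt (fun t : ℝ => y ⬝ᵥ (x + t • Pi.single i 1) + θ) (y i) 0 := by
      have : (fun t : ℝ => y ⬝ᵥ (x + t • Pi.single i 1) + θ) =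
          fun t => t * y i + (y ⬝ᵥ x + θ) := by
        funext t
        rw [dotProduct_add, dotProduct_smul, dotProduct_single]
        simp only [smul_eq_mul, mul_one]
        ring
      rw [this]
      simpa using ((hasDerivAt_id (0 : ℝ)).mul_const (y i)).add_const (y ⬝ᵥ x + θ)
    have h2 : HasDerivAt (iteratedDeriv (∑ j, k j) ρ)
        (iteratedDeriv (∑ j, k j + 1) ρ (y ⬝ᵥ x + θ))
        (y ⬝ᵥ (x + (0 : ℝ) • Pi.single i 1) + θ) := by
      rw [iteratedDeriv_succ, zero_smul, add_zero]
      exact ((hρ.differentiable_iteratedDeriv (∑ j, k j)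
        (by exact_mod_cast Nat.lt_of_succ_le hk)) _).hasDerivAt
    have h3 := (h2.comp (0 : ℝ) h1).const_mul (∏ j, y j ^ k j)
    have h4 : ∏ j, y j ^ (k + Pi.single i 1 : Fin d → ℕ) j = (∏ j, y j ^ k j) * y i := by
      simp only [Pi.add_apply, pow_add, Finset.prod_mul_distrib]
      congr 1
      rw [Finset.prod_eq_single i (fun j _ hj => by simp [hj]) (by simp)]
      simp
    rw [h4, mul_assoc, mul_comm (y i)]
    exact h3

theorem hasLineDerivAt_prod_apply {d : ℕ} {ψ : Fin d → ℝ → ℝ} (x : Fin d → ℝ) (i : Fin d)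
    {ψ' : ℝ} (h : HasDerivAt (ψ i) ψ' (x i)) :
    HasLineDerivAt ℝ (fun x => ∏ j, ψ j (x j)) (ψ' * ∏ j ∈ Finset.univ.erase i, ψ j (x j)) x
      (Pi.single i 1) := by
  have h1 : (fun t : ℝ => ∏ j, ψ j ((x + t • Pi.single i 1 : Fin d → ℝ) j)) =
      fun t => ψ i (x i + t) * ∏ j ∈ Finset.univ.erase i, ψ j (x j) := by
    funext t
    rw [← Finset.mul_prod_erase _ _ (Finset.mem_univ i)]
    congr 1
    · simp
    · refine Finset.prod_congr rfl fun j hj => ?_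
      simp [Finset.ne_of_mem_erase hj]
  unfold HasLineDerivAt
  rw [h1]
  refine HasDerivAt.mul_const ?_ _
  have h2 : HasDerivAt (ψ i) ψ' (x i + 0) := by simpa using h
  exact h2.comp_const_add (x i) 0

theorem hasLineDerivAt_prod_iteratedDeriv {d : ℕ} {ψ : Fin d → ℝ → ℝ}
    (hψ : ∀ j (n : ℕ), ContDiff ℝ n (ψ j)) (k : Fin d → ℕ) (x : Fin d → ℝ) (i : Fin d) :
    HasLineDerivAt ℝ (fun x => ∏ j, iteratedDeriv (k j) (ψ j) (x j))
      (∏ j, iteratedDeriv ((k + Pi.single i 1 : Fin d → ℕ) j) (ψ j) (x j)) x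
      (Pi.single i 1) := by
  have h : HasDerivAt (iteratedDeriv (k i) (ψ i)) (iteratedDeriv (k i + 1) (ψ i) (x i)) (x i) := by
    rw [iteratedDeriv_succ]
    exact (((hψ i (k i + 1)).differentiable_iteratedDeriv (k i)
      (by exact_mod_cast Nat.lt_succ_self _)) _).hasDerivAt
  convert hasLineDerivAt_prod_apply (ψ := fun j => iteratedDeriv (k j) (ψ j)) x i h using 1
  rw [← Finset.mul_prod_erase _ _ (Finset.mem_univ i)]
  congr 1
  · simp
  · refine Finset.prod_congr rfl fun j hj => ?_
    simp [Finset.ne_of_mem_erase hj]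

/-- The multi-index derivatives of a product of functions of one coordinate each. -/
theorem multiDeriv_prod {d : ℕ} {ψ : Fin d → ℝ → ℝ} (hψ : ∀ j (n : ℕ), ContDiff ℝ n (ψ j))
    (k : Fin d → ℕ) : multiDeriv k (fun x => ∏ j, ψ j (x j)) =
      fun x => ∏ j, iteratedDeriv (k j) (ψ j) (x j) := by
  induction k using multiIndex_induction with
  | zero => simp [multiDeriv_zero]
  | step k i hki ih =>
    rw [multiDeriv_add_single k i hki, ih]
    funext x
    exact (hasLineDerivAt_prod_iteratedDeriv hψ k x i).lineDeriv

/-! ### Polynomials and Taylor estimates in one variable -/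

theorem exists_derivative_eq (p : Polynomial ℝ) : ∃ q : Polynomial ℝ, q.derivative = p := by
  induction p using Polynomial.induction_on' with
  | add p q hp hq =>
    obtain ⟨a, rfl⟩ := hp
    obtain ⟨b, rfl⟩ := hq
    exact ⟨a + b, by simp⟩
  | monomial n a =>
    refine ⟨Polynomial.monomial (n + 1) (a / (n + 1)), ?_⟩
    have : (n : ℝ) + 1 ≠ 0 := by positivity
    simp [this]

/-- A function whose `n`-th derivative vanishes is a polynomial of degree `< n`. -/
theorem exists_polynomial_of_iteratedDeriv_eq_zero (n : ℕ) : ∀ {g : ℝ → ℝ},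
    ContDiff ℝ n g → (∀ t, iteratedDeriv n g t = 0) →
    ∃ p : Polynomial ℝ, p.degree < n ∧ ∀ t, g t = p.eval t := by
  induction n with
  | zero =>
    intro g _ h
    exact ⟨0, by simp, fun t => by simpa using h t⟩
  | succ n ih =>
    intro g hg h
    have hg' : ContDiff ℝ n (deriv g) := by
      have : ContDiff ℝ ((n : WithTop ℕ∞) + 1) g := by exact_mod_cast hg
      exact (contDiff_succ_iff_deriv.1 this).2.2
    obtain ⟨p, hp, hpg⟩ := ih hg' fun t => by rw [← iteratedDeriv_succ']; exact h t
    obtain ⟨q, rfl⟩ := exists_derivative_eq p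
    have hdiff : Differentiable ℝ g := hg.differentiable (by simp)
    have hconst : ∀ t, g t - q.eval t = g 0 - q.eval 0 := by
      intro t
      refine is_const_of_deriv_eq_zero (f := fun t => g t - q.eval t)
        (hdiff.sub q.differentiable) (fun s => ?_) t 0
      rw [deriv_fun_sub (hdiff s) (q.differentiable s), hpg s, Polynomial.deriv, sub_self]
    refine ⟨q + Polynomial.C (g 0 - q.eval 0), ?_, fun t => ?_⟩
    · refine (Polynomial.degree_add_le _ _).trans_lt (max_lt ?_ ?_)
      · by_contra hcon
        rw [not_lt] at hcon
        have hnat : n + 1 ≤ q.natDegree := Polynomial.le_natDegree_of_coe_le_degree hcon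
        have h1 : q.derivative.natDegree = q.natDegree - 1 := Polynomial.natDegree_derivative q
        have h2 : q.derivative ≠ 0 := by
          intro h0
          have := Polynomial.derivative_eq_zero.1 h0
          omega
        rw [Polynomial.degree_eq_natDegree h2, h1] at hp
        have : q.natDegree - 1 < n := by exact_mod_cast hp
        omega
      · exact Polynomial.degree_C_le.trans_lt (by exact_mod_cast Nat.succ_pos n)
    · rw [Polynomial.eval_add, Polynomial.eval_C, ← hconst t]
      ring

/-- A pointwise limit of polynomials of bounded degree is a polynomial. -/
theorem exists_polynomial_of_tendsto {n : ℕ} {σ : ℝ → ℝ} {p : ℕ → Polynomial ℝ}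
    (hp : ∀ j, (p j).degree < n) (h : ∀ t, Tendsto (fun j => (p j).eval t) atTop (𝓝 (σ t))) :
    ∃ q : Polynomial ℝ, ∀ t, σ t = q.eval t := by
  -- A polynomial of degree `< n` is a fixed combination of its values at `0, …, n - 1`, so
  -- pointwise convergence at these nodes determines the limit everywhere.
  have hinj : Set.InjOn (fun i : ℕ => (i : ℝ)) (Finset.range n : Set ℕ) :=
    Nat.cast_injective.injOn
  refine ⟨Lagrange.interpolate (Finset.range n) (fun i : ℕ => (i : ℝ)) fun i => σ i,
    fun t => tendsto_nhds_unique (h t) ?_⟩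
  have heq : ∀ j, (p j).eval t = ∑ i ∈ Finset.range n,
      (p j).eval (i : ℝ) * (Lagrange.basis (Finset.range n) (fun i : ℕ => (i : ℝ)) i).eval t := by
    intro j
    conv_lhs => rw [Lagrange.eq_interpolate (f := p j) hinj (by simpa using hp j)]
    simp [Lagrange.interpolate_apply, Polynomial.eval_finsetSum]
  simp only [heq, Lagrange.interpolate_apply, Polynomial.eval_finsetSum, Polynomial.eval_mul,
    Polynomial.eval_C]
  exact tendsto_finsetSum _ fun i _ => (h i).mul_const _

/-- Weierstrass approximation of a function together with its derivatives up to order `n`. -/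
theorem exists_polynomial_iteratedDeriv_near (n : ℕ) (R : ℝ) : ∀ {g : ℝ → ℝ},
    ContDiff ℝ n g → ∀ ε > 0, ∃ p : Polynomial ℝ, ∀ j ≤ n, ∀ t ∈ Set.Icc (-R) R,
      |iteratedDeriv j g t - iteratedDeriv j (fun s => p.eval s) t| < ε := by
  induction n with
  | zero =>
    intro g hg ε hε
    obtain ⟨p, hp⟩ := exists_polynomial_near_of_continuousOn (-R) R g hg.continuous.continuousOn
      ε hε
    refine ⟨p, fun j hj t ht => ?_⟩
    obtain rfl : j = 0 := by omega
    rw [iteratedDeriv_zero, iteratedDeriv_zero, abs_sub_comm]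
    exact hp t ht
  | succ n ih =>
    intro g hg ε hε
    have hg' : ContDiff ℝ n (deriv g) := by
      have : ContDiff ℝ ((n : WithTop ℕ∞) + 1) g := by exact_mod_cast hg
      exact (contDiff_succ_iff_deriv.1 this).2.2
    -- The mean value inequality from `0` costs a factor `|t| ≤ |R|`; the `+ 1` keeps the
    -- denominator positive and gives `η ≤ ε`.
    set η := ε / (|R| + 1) with hη
    have hηpos : 0 < η := by positivity
    have hηε : η ≤ ε := div_le_self hε.le (by linarith [abs_nonneg R])
    obtain ⟨p, hp⟩ := ih hg' η hηpos
    obtain ⟨q, rfl⟩ := exists_derivative_eq p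
    -- The constant of integration makes `P` agree with `g` at `0`.
    set P : Polynomial ℝ := q + Polynomial.C (g 0 - q.eval 0) with hP
    have hderiv : deriv (fun s => P.eval s) = fun s => q.derivative.eval s := by
      funext s
      rw [Polynomial.deriv]
      simp [hP]
    have hdiff : Differentiable ℝ g := hg.differentiable (by simp)
    refine ⟨P, fun j hj t ht => ?_⟩
    rcases j with _ | j
    · rw [iteratedDeriv_zero, iteratedDeriv_zero]
      have hR : 0 ≤ R := by linarith [ht.1, ht.2]
      have h0 : (0 : ℝ) ∈ Set.Icc (-R) R := ⟨by linarith, hR⟩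
      have hmv := (convex_Icc (-R) R).norm_image_sub_le_of_norm_deriv_le
        (f := fun s => g s - P.eval s) (C := η) (x := 0) (y := t)
        (fun s _ => (hdiff s).sub (P.differentiable s))
        (fun s hs => by
          rw [deriv_fun_sub (hdiff s) (P.differentiable s), hderiv]
          exact (hp 0 (Nat.zero_le n) s hs).le) h0 ht
      have hz : g 0 - P.eval 0 = 0 := by simp [hP]
      rw [hz, sub_zero, sub_zero, Real.norm_eq_abs, Real.norm_eq_abs] at hmv
      have htR : |t| ≤ |R| := by
        rw [abs_of_nonneg hR]
        exact abs_le.2 ht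
      calc |g t - P.eval t| ≤ η * |t| := hmv
        _ ≤ η * |R| := by gcongr
        _ < η * (|R| + 1) := by linarith
        _ = ε := by rw [hη]; field_simp
    · rw [iteratedDeriv_succ', iteratedDeriv_succ', hderiv]
      exact (hp j (by omega) t ht).trans_le hηε

/-- A function whose derivatives of order less than `m` vanish at `0` is `O(|u| ^ m)` on bounded
sets. -/
theorem exists_abs_le_mul_abs_pow (R : ℝ) (m : ℕ) : ∀ {h : ℝ → ℝ}, ContDiff ℝ m h →
    (∀ i < m, iteratedDeriv i h 0 = 0) → ∃ C, 0 ≤ C ∧ ∀ u, |u| ≤ R → |h u| ≤ C * |u| ^ m := by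
  induction m with
  | zero =>
    intro h hh _
    obtain ⟨C, hC⟩ := (isCompact_Icc (a := -R) (b := R)).exists_bound_of_continuousOn
      hh.continuous.continuousOn
    refine ⟨|C|, abs_nonneg C, fun u hu => ?_⟩
    simpa using (hC u (abs_le.1 hu)).trans (le_abs_self C)
  | succ m ih =>
    intro h hh hz
    have hh' : ContDiff ℝ m (deriv h) := by
      have : ContDiff ℝ ((m : WithTop ℕ∞) + 1) h := by exact_mod_cast hh
      exact (contDiff_succ_iff_deriv.1 this).2.2
    obtain ⟨C, hC0, hC⟩ := ih hh' fun i hi => by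
      rw [← iteratedDeriv_succ']; exact hz (i + 1) (by omega)
    refine ⟨C, hC0, fun u hu => ?_⟩
    have hmv := (convex_Icc (-|u|) |u|).norm_image_sub_le_of_norm_deriv_le
      (f := h) (C := C * |u| ^ m) (x := 0) (y := u)
      (fun s _ => hh.differentiable (by simp) s)
      (fun s hs => by
        have hs' : |s| ≤ |u| := abs_le.2 hs
        refine (hC s (hs'.trans hu)).trans ?_
        gcongr) ⟨by simp, by simp⟩ (abs_le.1 le_rfl)
    have h0 : h 0 = 0 := by simpa using hz 0 (Nat.succ_pos m)
    rw [h0, sub_zero, sub_zero, Real.norm_eq_abs, Real.norm_eq_abs] at hmv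
    rw [pow_succ, ← mul_assoc]
    exact hmv

/-! ### Regularization of the activation function -/

/-- The derivatives of the convolution of a test function with `σ` fall on `σ`. -/
theorem iteratedDeriv_integral_mul_comp_sub {r : ℕ} {σ φ : ℝ → ℝ} (hσ : ContDiff ℝ r σ)
    (hφ : ContDiff ℝ 1 φ) (hφc : HasCompactSupport φ) (j : ℕ) (hj : j ≤ r) :
    iteratedDeriv j (fun t => ∫ s, φ s * σ (t - s)) =
      fun t => ∫ s, φ s * iteratedDeriv j σ (t - s) := by
  induction j with
  | zero => simp
  | succ j ih =>
    rw [iteratedDeriv_succ, ih (by omega)]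
    funext t
    set τ := iteratedDeriv j σ with hτ
    have hτc : Continuous τ := hσ.continuous_iteratedDeriv j (by exact_mod_cast (by omega))
    have hτd : Differentiable ℝ τ := hσ.differentiable_iteratedDeriv j (by exact_mod_cast hj)
    have hτ'c : Continuous (iteratedDeriv (j + 1) σ) :=
      hσ.continuous_iteratedDeriv (j + 1) (by exact_mod_cast hj)
    have hconv := hφc.hasDerivAt_convolution_left (ContinuousLinearMap.mul ℝ ℝ) hφ
      hτc.locallyIntegrable (μ := volume) t
    have hφ'c : HasCompactSupport (deriv φ) := hφc.deriv
    have hφd : Differentiable ℝ φ := hφ.differentiable (by simp)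
    have hφ' : Continuous (deriv φ) := hφ.continuous_deriv (by simp)
    have hsub : Continuous fun s : ℝ => t - s := continuous_const.sub continuous_id
    -- `hconv` puts the derivative on the test function; integration by parts carries it over to
    -- `τ`.
    have hparts := integral_mul_deriv_eq_deriv_mul_of_integrable
      (u := φ) (v := fun s => τ (t - s)) (u' := deriv φ)
      (v' := fun s => - iteratedDeriv (j + 1) σ (t - s))
      (fun s _ => (hφd s).hasDerivAt)
      (fun s _ => by
        have h1 : HasDerivAt τ (iteratedDeriv (j + 1) σ (t - s)) (t - s) := by
          rw [iteratedDeriv_succ]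
          exact (hτd _).hasDerivAt
        exact HasDerivAt.comp_const_sub t s h1)
      ((hφ.continuous.mul (hτ'c.comp hsub).neg).integrable_of_hasCompactSupport hφc.mul_right)
      ((hφ'.mul (hτc.comp hsub)).integrable_of_hasCompactSupport hφ'c.mul_right)
      ((hφ.continuous.mul (hτc.comp hsub)).integrable_of_hasCompactSupport hφc.mul_right)
    have hval : (∫ s, φ s * iteratedDeriv (j + 1) σ (t - s)) =
        convolution (deriv φ) τ (ContinuousLinearMap.mul ℝ ℝ) volume t := by
      simp only [mul_neg, integral_neg, neg_inj] at hparts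
      rw [hparts]
      rfl
    rw [hval]
    exact hconv.deriv

theorem contDiff_integral_mul_comp_sub {n : ℕ} {σ φ : ℝ → ℝ} (hσ : Continuous σ)
    (hφ : ContDiff ℝ n φ) (hφc : HasCompactSupport φ) :
    ContDiff ℝ n (fun t => ∫ s, φ s * σ (t - s)) :=
  hφc.contDiff_convolution_left (n := n) (ContinuousLinearMap.mul ℝ ℝ) hφ
    hσ.locallyIntegrable (μ := volume)

/-- If `σ` is not a polynomial, then its regularizations have non-vanishing derivatives of every
order. -/
theorem exists_iteratedDeriv_regularization_ne_zero {σ : ℝ → ℝ} (hσ : Continuous σ)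
    (hnp : ¬ ∃ p : Polynomial ℝ, ∀ t, σ t = p.eval t) (n : ℕ) :
    ∃ (φ : ℝ → ℝ) (θ : ℝ), (∀ m : ℕ, ContDiff ℝ m φ) ∧ HasCompactSupport φ ∧
      iteratedDeriv n (fun t => ∫ s, φ s * σ (t - s)) θ ≠ 0 := by
  by_contra! hcon
  -- Bumps of radius tending to `0` form an approximate identity; by `hcon` each regularization is a
  -- polynomial of degree `< n`.
  let b : ℕ → ContDiffBump (0 : ℝ) := fun j =>
    { rIn := 1 / ((j : ℝ) + 1) / 2
      rOut := 1 / ((j : ℝ) + 1)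
      rIn_pos := by positivity
      rIn_lt_rOut := half_lt_self (by positivity) }
  have hb : Tendsto (fun j => (b j).rOut) atTop (𝓝 0) := tendsto_one_div_add_atTop_nhds_zero_nat
  have hsm : ∀ j, ∀ m : ℕ, ContDiff ℝ m ((b j).normed volume) := fun j m => (b j).contDiff_normed
  have hc : ∀ j, HasCompactSupport ((b j).normed volume) := fun j =>
    (b j).hasCompactSupport_normed
  choose p hpdeg hp using fun j => exists_polynomial_of_iteratedDeriv_eq_zero n
    (contDiff_integral_mul_comp_sub hσ (hsm j n) (hc j))
    fun t => hcon ((b j).normed volume) t (hsm j) (hc j)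
  refine hnp (exists_polynomial_of_tendsto hpdeg fun t => ?_)
  simp only [← hp]
  exact ContDiffBump.convolution_tendsto_right_of_continuous (μ := volume) hb hσ t

/-! ### Jets and the closed span of network jets -/

/-- The `C^r` functions on `ℝᵈ`. -/
def contDiffSubmodule (d r : ℕ) : Submodule ℝ ((Fin d → ℝ) → ℝ) where
  carrier := {g | ContDiff ℝ r g}
  add_mem' := by
    intro g h hg hh
    rw [Set.mem_ofPred_eq] at *
    exact hg.add hh
  zero_mem' := by
    rw [Set.mem_ofPred_eq]
    exact contDiff_const
  smul_mem' := by
    intro c g hg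
    rw [Set.mem_ofPred_eq] at *
    exact hg.const_smul c

theorem mem_contDiffSubmodule {d r : ℕ} {g : (Fin d → ℝ) → ℝ} :
    g ∈ contDiffSubmodule d r ↔ ContDiff ℝ r g :=
  Iff.rfl

/-- Otherwise a continuous functional separates the integral from `M`. Being bounded above on a
subspace, it vanishes there; it commutes with the integral, so it vanishes on the integral too. -/
theorem Submodule.integral_mem_of_isClosed {α E : Type*} [MeasurableSpace α] {μ : Measure α}
    [NormedAddCommGroup E] [NormedSpace ℝ E] [CompleteSpace E] (M : Submodule ℝ E)
    (hM : IsClosed (M : Set E)) {F : α → E} (hF : Integrable F μ) (hFM : ∀ a, F a ∈ M) :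
    ∫ a, F a ∂μ ∈ M := by
  by_contra hcon
  obtain ⟨L, u, hL, hu⟩ := geometric_hahn_banach_closed_point M.convex hM hcon
  have hzero : ∀ v ∈ M, L v = 0 := by
    intro v hv
    by_contra hne
    have := hL _ (M.smul_mem ((u + 1) / L v) hv)
    rw [map_smul, smul_eq_mul, div_mul_cancel₀ _ hne] at this
    linarith
  have hu0 : 0 < u := by simpa using hL 0 M.zero_mem
  rw [← L.integral_comp_comm hF] at hu
  simp [hzero _ (hFM _)] at hu
  linarith

theorem integral_apply_apply {α ι Y : Type*} [MeasurableSpace α] {μ : Measure α} [Fintype ι]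
    [TopologicalSpace Y] [CompactSpace Y] {F : α → ι → C(Y, ℝ)} (hF : Integrable F μ) (i : ι)
    (x : Y) : (∫ a, F a ∂μ) i x = ∫ a, F a i x ∂μ :=
  (((ContinuousMap.evalCLM ℝ x).comp
    (ContinuousLinearMap.proj (R := ℝ) (φ := fun _ : ι => C(Y, ℝ)) i)).integral_comp_comm hF).symm

section Jet

variable {d r : ℕ} {ι : Type*}

/-- The restrictions to `X` of the derivatives `D^k g`, for finitely many multi-indices `k`. -/
noncomputable def jet (κ : ι → Fin d → ℕ) (hκ : ∀ i, ∑ j, κ i j ≤ r) (X : Set (Fin d → ℝ)) :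
    contDiffSubmodule d r →ₗ[ℝ] ι → C(X, ℝ) where
  toFun g i := ⟨fun x => multiDeriv (κ i) g x,
    (continuous_multiDeriv (mem_contDiffSubmodule.1 g.2) (hκ i)).comp continuous_subtype_val⟩
  map_add' g h := by
    ext i x
    exact congrFun (multiDeriv_add (mem_contDiffSubmodule.1 g.2) (mem_contDiffSubmodule.1 h.2) (κ i) (hκ i)) x
  map_smul' c g := by
    ext i x
    exact congrFun (multiDeriv_smul c (mem_contDiffSubmodule.1 g.2) (κ i) (hκ i)) x

theorem contDiff_ridge {ρ : ℝ → ℝ} (hρ : ContDiff ℝ r ρ) (y : Fin d → ℝ) (θ : ℝ) :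
    ContDiff ℝ r (fun x : Fin d → ℝ => ρ (y ⬝ᵥ x + θ)) := by
  refine hρ.comp (ContDiff.add ?_ contDiff_const)
  unfold dotProduct
  fun_prop

/-- The ridge function `x ↦ ρ (y ⬝ᵥ x + θ)`. -/
noncomputable def ridge (ρ : ℝ → ℝ) (hρ : ContDiff ℝ r ρ) (y : Fin d → ℝ) (θ : ℝ) : contDiffSubmodule d r :=
  ⟨fun x => ρ (y ⬝ᵥ x + θ), contDiff_ridge hρ y θ⟩

variable (κ : ι → Fin d → ℕ) (hκ : ∀ i, ∑ j, κ i j ≤ r) (X : Set (Fin d → ℝ))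

theorem jet_ridge {ρ : ℝ → ℝ} (hρ : ContDiff ℝ r ρ) (y : Fin d → ℝ) (θ : ℝ) (i : ι) (x : X) :
    jet κ hκ X (ridge ρ hρ y θ) i x =
      (∏ j, y j ^ κ i j) * iteratedDeriv (∑ j, κ i j) ρ (y ⬝ᵥ (x : Fin d → ℝ) + θ) :=
  congrFun (multiDeriv_ridge hρ y θ (κ i) (hκ i)) x

/-- The closed span of the jets of the functions `x ↦ σ (y ⬝ᵥ x + θ)`. -/
noncomputable def networkJets (σ : ℝ → ℝ) (hσ : ContDiff ℝ r σ) : Submodule ℝ (ι → C(X, ℝ)) :=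
  (Submodule.span ℝ (Set.range fun p : (Fin d → ℝ) × ℝ =>
    jet κ hκ X (ridge σ hσ p.1 p.2))).topologicalClosure

variable {σ : ℝ → ℝ} (hσ : ContDiff ℝ r σ)

theorem isClosed_networkJets :
    IsClosed (networkJets κ hκ X σ hσ : Set (ι → C(X, ℝ))) :=
  Submodule.isClosed_topologicalClosure _

theorem jet_ridge_mem_networkJets (y : Fin d → ℝ) (θ : ℝ) :
    jet κ hκ X (ridge σ hσ y θ) ∈ networkJets κ hκ X σ hσ :=
  Submodule.le_topologicalClosure _ (Submodule.subset_span ⟨(y, θ), rfl⟩)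

variable [Fintype ι] [CompactSpace X]

/-- The jet is the integral over `s` of `φ s` times the jet of the ridge function with offset `θ -
s`, and each integrand lies in the closed subspace. -/
theorem jet_ridge_regularization_mem {φ : ℝ → ℝ} (hφ : ContDiff ℝ 1 φ)
    (hφc : HasCompactSupport φ) (hρ : ContDiff ℝ r fun t => ∫ s, φ s * σ (t - s))
    (y : Fin d → ℝ) (θ : ℝ) :
    jet κ hκ X (ridge (fun t => ∫ s, φ s * σ (t - s)) hρ y θ) ∈ networkJets κ hκ X σ hσ := by
  set F : ℝ → ι → C(X, ℝ) := fun s => φ s • jet κ hκ X (ridge σ hσ y (θ - s)) with hF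
  have hcont : Continuous F := by
    refine hφ.continuous.smul (continuous_pi fun i => ?_)
    -- Continuity into the space of functions on `X` follows from joint continuity in `(s, x)`.
    refine ContinuousMap.continuous_of_continuous_uncurry _ ?_
    have : (Function.uncurry fun (s : ℝ) (x : X) => jet κ hκ X (ridge σ hσ y (θ - s)) i x) =
        fun p : ℝ × X => (∏ j, y j ^ κ i j) *
          iteratedDeriv (∑ j, κ i j) σ (y ⬝ᵥ (p.2 : Fin d → ℝ) + (θ - p.1)) := by
      funext p
      exact jet_ridge κ hκ X hσ y (θ - p.1) i p.2
    rw [this]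
    have hx : Continuous fun p : ℝ × X => (p.2 : Fin d → ℝ) :=
      continuous_subtype_val.comp continuous_snd
    refine continuous_const.mul ((hσ.continuous_iteratedDeriv _
      (by exact_mod_cast hκ i)).comp ?_)
    refine Continuous.add ?_ (by fun_prop)
    exact continuous_finsetSum _ fun j _ =>
      continuous_const.mul ((continuous_apply j).comp hx)
  have hint : Integrable F := hcont.integrable_of_hasCompactSupport hφc.smul_right
  have hmem := (networkJets κ hκ X σ hσ).integral_mem_of_isClosed
    (isClosed_networkJets κ hκ X hσ) hint
    fun s => Submodule.smul_mem _ _ (jet_ridge_mem_networkJets κ hκ X hσ y (θ - s))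
  convert hmem using 1
  ext i x
  rw [integral_apply_apply hint, jet_ridge,
    iteratedDeriv_integral_mul_comp_sub hσ hφ hφc _ (hκ i), ← integral_const_mul]
  refine integral_congr_ae (Eventually.of_forall fun s => ?_)
  simp only [hF, Pi.smul_apply, ContinuousMap.smul_apply, smul_eq_mul]
  rw [jet_ridge, add_sub_assoc]
  ring

end Jet

/-! ### Powers of linear forms via Taylor expansion -/

theorem iteratedDeriv_eval (p : Polynomial ℝ) (n : ℕ) :
    iteratedDeriv n (fun t => p.eval t) = fun t => (Polynomial.derivative^[n] p).eval t := by
  induction n with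
  | zero => simp
  | succ n ih =>
    rw [iteratedDeriv_succ, ih, Function.iterate_succ_apply']
    funext t
    exact Polynomial.deriv _

theorem contDiff_eval (p : Polynomial ℝ) (n : WithTop ℕ∞) : ContDiff ℝ n fun t => p.eval t := by
  simpa [Polynomial.coe_aeval_eq_eval] using p.contDiff_aeval (𝕜 := ℝ) n

theorem iteratedDeriv_iteratedDeriv (i j : ℕ) (f : ℝ → ℝ) :
    iteratedDeriv i (iteratedDeriv j f) = iteratedDeriv (i + j) f := by
  simp only [iteratedDeriv_eq_iterate, Function.iterate_add_apply]

/-- The Taylor polynomial of degree `n` of `ρ` at `θ`, in powers of the increment. -/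
noncomputable def taylorPolynomial (ρ : ℝ → ℝ) (θ : ℝ) (n : ℕ) : Polynomial ℝ :=
  ∑ i ∈ Finset.range (n + 1), Polynomial.monomial i (iteratedDeriv i ρ θ / i.factorial)

theorem eval_taylorPolynomial (ρ : ℝ → ℝ) (θ : ℝ) (n : ℕ) (u : ℝ) :
    (taylorPolynomial ρ θ n).eval u =
      ∑ i ∈ Finset.range (n + 1), iteratedDeriv i ρ θ / i.factorial * u ^ i := by
  simp only [taylorPolynomial, Polynomial.eval_finsetSum, Polynomial.eval_monomial]

theorem iteratedDeriv_sub_taylorPolynomial {ρ : ℝ → ℝ} (hρ : ∀ m : ℕ, ContDiff ℝ m ρ) (θ : ℝ)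
    {n i : ℕ} (hi : i ≤ n) :
    iteratedDeriv i (fun u => ρ (u + θ) - (taylorPolynomial ρ θ n).eval u) 0 = 0 := by
  have h1 : ContDiff ℝ i fun u => ρ (u + θ) := (hρ i).comp (contDiff_id.add contDiff_const)
  rw [iteratedDeriv_fun_sub h1.contDiffAt
    (contDiff_eval (taylorPolynomial ρ θ n) i).contDiffAt, iteratedDeriv_eval,
    iteratedDeriv_comp_add_const]
  have h2 : (taylorPolynomial ρ θ n).coeff i = iteratedDeriv i ρ θ / i.factorial := by
    simp [taylorPolynomial, Polynomial.finsetSum_coeff, Polynomial.coeff_monomial]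
    omega
  simp only [zero_add]
  rw [← Polynomial.coeff_zero_eq_eval_zero, Polynomial.coeff_iterate_derivative, zero_add, h2,
    Nat.descFactorial_self, nsmul_eq_mul,
    mul_div_cancel₀ _ (by exact_mod_cast Nat.factorial_ne_zero i), sub_self]

section Jet

variable {d r : ℕ} {ι : Type*} (κ : ι → Fin d → ℕ) (hκ : ∀ i, ∑ j, κ i j ≤ r)
  (X : Set (Fin d → ℝ)) {σ : ℝ → ℝ} (hσ : ContDiff ℝ r σ)

/-- The jets of `g (λ (y ⬝ᵥ x))` are `O(|λ| ^ (n + 1))` if `g` vanishes to order `n` at `0`. -/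
theorem exists_norm_jet_ridge_le [CompactSpace X] {g : ℝ → ℝ} (hg : ∀ m : ℕ, ContDiff ℝ m g)
    {n : ℕ} (hz : ∀ i ≤ n, iteratedDeriv i g 0 = 0) (y : Fin d → ℝ) (i : ι) :
    ∃ C, 0 ≤ C ∧ ∀ c : ℝ, |c| ≤ 1 →
      ‖jet κ hκ X (ridge g (hg r) (c • y) 0) i‖ ≤ C * |c| ^ (n + 1) := by
  obtain ⟨R, hR⟩ := (isCompact_iff_compactSpace.2 ‹CompactSpace X›).exists_bound_of_continuousOn
    (f := fun x : Fin d → ℝ => y ⬝ᵥ x) (by unfold dotProduct; fun_prop)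
  set j := ∑ l, κ i l with hj
  -- A derivative of order `j` produces the factor `c ^ j` and leaves `g⁽ʲ⁾ = O(|u| ^ (n + 1 - j))`.
  -- With truncated subtraction this also covers `j > n + 1`; the total exponent is at least `n +
  -- 1`, which suffices since `|c| ≤ 1`.
  have hgj : ContDiff ℝ (n + 1 - j : ℕ) (iteratedDeriv j g) := by
    have := hg ((n + 1 - j) + j)
    rw [iteratedDeriv_eq_iterate]
    exact ContDiff.iterate_deriv' (n + 1 - j) j this
  obtain ⟨C, hC0, hC⟩ := exists_abs_le_mul_abs_pow |R| (n + 1 - j) hgj fun l hl => by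
    rw [iteratedDeriv_iteratedDeriv]
    exact hz _ (by omega)
  refine ⟨|∏ l, y l ^ κ i l| * (C * |R| ^ (n + 1 - j)), by positivity, fun c hc => ?_⟩
  rw [ContinuousMap.norm_le _ (by positivity)]
  intro x
  have hyx : |y ⬝ᵥ (x : Fin d → ℝ)| ≤ |R| := (hR x x.2).trans (le_abs_self R)
  have h1 : ∏ l, (c • y) l ^ κ i l = c ^ j * ∏ l, y l ^ κ i l := by
    simp [mul_pow, Finset.prod_mul_distrib, Finset.prod_pow_eq_pow_sum, hj]
  have h2 : |c * (y ⬝ᵥ (x : Fin d → ℝ))| ≤ |R| := by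
    rw [abs_mul]
    exact (mul_le_of_le_one_left (abs_nonneg _) hc).trans hyx
  rw [jet_ridge, h1, add_zero, smul_dotProduct, smul_eq_mul, Real.norm_eq_abs, abs_mul, abs_mul,
    abs_pow]
  calc |c| ^ j * |∏ l, y l ^ κ i l| * |iteratedDeriv j g (c * y ⬝ᵥ (x : Fin d → ℝ))|
      ≤ |c| ^ j * |∏ l, y l ^ κ i l| * (C * |c * y ⬝ᵥ (x : Fin d → ℝ)| ^ (n + 1 - j)) := by
        gcongr
        exact hC _ h2
    _ ≤ |c| ^ j * |∏ l, y l ^ κ i l| * (C * (|c| ^ (n + 1 - j) * |R| ^ (n + 1 - j))) := by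
        rw [abs_mul, mul_pow]
        gcongr
    _ = |∏ l, y l ^ κ i l| * (C * |R| ^ (n + 1 - j)) * |c| ^ (j + (n + 1 - j)) := by
        rw [pow_add]
        ring
    _ ≤ |∏ l, y l ^ κ i l| * (C * |R| ^ (n + 1 - j)) * |c| ^ (n + 1) := by
        gcongr ?_ * ?_
        exact pow_le_pow_of_le_one (abs_nonneg c) hc (by omega)

theorem contDiff_pow_nat (r n : ℕ) : ContDiff ℝ r fun t : ℝ => t ^ n :=
  contDiff_id.pow n

/-- The jets of the powers of linear forms are limits of jets of networks. -/
theorem jet_ridge_pow_mem [Fintype ι] [CompactSpace X]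
    (hnp : ¬ ∃ p : Polynomial ℝ, ∀ t, σ t = p.eval t) (y : Fin d → ℝ) (n : ℕ) :
    jet κ hκ X (ridge (fun t => t ^ n) (contDiff_pow_nat r n) y 0) ∈
      networkJets κ hκ X σ hσ := by
  induction n using Nat.strong_induction_on with
  | _ n ih =>
  obtain ⟨φ, θ, hφ, hφc, hne⟩ := exists_iteratedDeriv_regularization_ne_zero hσ.continuous hnp n
  set ρ : ℝ → ℝ := fun t => ∫ s, φ s * σ (t - s) with hρdef
  have hρ : ∀ m : ℕ, ContDiff ℝ m ρ := fun m =>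
    contDiff_integral_mul_comp_sub hσ.continuous (hφ m) hφc
  set a : ℕ → ℝ := fun i => iteratedDeriv i ρ θ / i.factorial with ha
  have han : a n ≠ 0 := div_ne_zero hne (by exact_mod_cast Nat.factorial_ne_zero n)
  set g : ℝ → ℝ := fun u => ρ (u + θ) - (taylorPolynomial ρ θ n).eval u with hgdef
  have hg : ∀ m : ℕ, ContDiff ℝ m g := fun m =>
    ((hρ m).comp (contDiff_id.add contDiff_const)).sub (contDiff_eval _ m)
  have hz : ∀ i ≤ n, iteratedDeriv i g 0 = 0 := fun i hi =>
    iteratedDeriv_sub_taylorPolynomial hρ θ hi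
  set P : ℕ → contDiffSubmodule d r := fun i =>
    ridge (fun t => t ^ i) (contDiff_pow_nat r i) y 0 with hP
  -- The Taylor term of order `n` is kept on the left with the remainder; the right side lies in the
  -- span by regularization and induction.
  have hsplit : ∀ c : ℝ, ridge g (hg r) (c • y) 0 + (a n * c ^ n) • P n =
      ridge ρ (hρ r) (c • y) θ - ∑ i ∈ Finset.range n, (a i * c ^ i) • P i := by
    intro c
    apply Subtype.ext
    funext x
    simp only [Submodule.coe_add, Submodule.coe_sub, Submodule.coe_sum, Submodule.coe_smul,
      Pi.add_apply, Pi.sub_apply, Finset.sum_apply, Pi.smul_apply, smul_eq_mul, hP, ridge,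
      smul_dotProduct, hgdef, eval_taylorPolynomial, add_zero, Finset.sum_range_succ, mul_pow,
      ha]
    simp only [mul_assoc]
    ring
  have hmem : ∀ c : ℝ, jet κ hκ X (ridge g (hg r) (c • y) 0) + (a n * c ^ n) • jet κ hκ X (P n) ∈
      networkJets κ hκ X σ hσ := by
    intro c
    rw [← map_smul, ← map_add, hsplit, map_sub, map_sum]
    refine Submodule.sub_mem _ (jet_ridge_regularization_mem κ hκ X hσ (hφ 1) hφc (hρ r) _ _)
      (Submodule.sum_mem _ fun i hi => ?_)
    rw [map_smul]
    exact Submodule.smul_mem _ _ (ih i (Finset.mem_range.1 hi))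
  -- After division by `a n * c ^ n` the remainder is `O(|c|)`.
  have hlim : Tendsto (fun c : ℝ => (a n * c ^ n)⁻¹ •
      (jet κ hκ X (ridge g (hg r) (c • y) 0) + (a n * c ^ n) • jet κ hκ X (P n)))
      (𝓝[≠] 0) (𝓝 (jet κ hκ X (P n))) := by
    have hsmall : Tendsto (fun c : ℝ => (a n * c ^ n)⁻¹ •
        jet κ hκ X (ridge g (hg r) (c • y) 0)) (𝓝[≠] 0) (𝓝 0) := by
      rw [tendsto_pi_nhds]
      intro i
      obtain ⟨C, hC0, hC⟩ := exists_norm_jet_ridge_le κ hκ X hg hz y i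
      have hbound : Tendsto (fun c : ℝ => |a n|⁻¹ * C * |c|) (𝓝[≠] 0) (𝓝 0) := by
        have : Tendsto (fun c : ℝ => |a n|⁻¹ * C * |c|) (𝓝 0) (𝓝 (|a n|⁻¹ * C * |0|)) :=
          (continuous_const.mul continuous_abs).tendsto 0
        rw [abs_zero, mul_zero] at this
        exact this.mono_left nhdsWithin_le_nhds
      refine squeeze_zero_norm' ?_ hbound
      have hnear : ∀ᶠ c : ℝ in 𝓝[≠] 0, |c| ≤ 1 :=
        nhdsWithin_le_nhds (by
          filter_upwards [Metric.closedBall_mem_nhds (0 : ℝ) one_pos] with c hc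
          simpa using hc)
      filter_upwards [hnear, self_mem_nhdsWithin] with c hc hc0
      have hc0' : |c| ≠ 0 := abs_ne_zero.2 hc0
      rw [Pi.smul_apply, norm_smul, norm_inv, Real.norm_eq_abs, abs_mul, abs_pow]
      calc (|a n| * |c| ^ n)⁻¹ * ‖jet κ hκ X (ridge g (hg r) (c • y) 0) i‖
          ≤ (|a n| * |c| ^ n)⁻¹ * (C * |c| ^ (n + 1)) := by
            gcongr
            exact hC c hc
        _ = |a n|⁻¹ * C * |c| := by
            rw [mul_inv, pow_succ]
            field_simp
    have h := hsmall.add_const (jet κ hκ X (P n))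
    rw [zero_add] at h
    refine h.congr' ?_
    filter_upwards [self_mem_nhdsWithin] with c hc0
    rw [smul_add, smul_smul, inv_mul_cancel₀ (mul_ne_zero han (pow_ne_zero n hc0)), one_smul]
  exact (isClosed_networkJets κ hκ X hσ).mem_of_tendsto hlim
    (Eventually.of_forall fun c => Submodule.smul_mem _ _ (hmem c))

end Jet

/-! ### Polarization -/

theorem Submodule.coeff_mem_of_forall_sum_pow_smul_mem {V : Type*} [AddCommGroup V] [Module ℝ V]
    (W : Submodule ℝ V) (n : ℕ) (v : ℕ → V)
    (h : ∀ c : ℝ, ∑ i ∈ Finset.range n, c ^ i • v i ∈ W) {i : ℕ} (hi : i < n) : v i ∈ W := by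
  by_contra hcon
  -- A functional vanishing on `W` but not at `v i` would turn the sum into a real polynomial in `c`
  -- that is identically zero yet has a nonzero coefficient.
  obtain ⟨f, hf, hW⟩ := Submodule.exists_le_ker_of_notMem hcon
  set p : Polynomial ℝ := ∑ i ∈ Finset.range n, Polynomial.monomial i (f (v i)) with hp
  have hp0 : p = 0 := by
    refine Polynomial.funext fun c => ?_
    have := LinearMap.mem_ker.1 (hW (h c))
    rw [map_sum] at this
    simp only [map_smul, smul_eq_mul] at this
    rw [hp, Polynomial.eval_finsetSum, Polynomial.eval_zero, ← this]
    exact Finset.sum_congr rfl fun i _ => by rw [Polynomial.eval_monomial, mul_comm]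
  refine hf ?_
  have : p.coeff i = f (v i) := by
    simp [hp, Polynomial.finsetSum_coeff, Polynomial.coeff_monomial]
    omega
  rw [← this, hp0, Polynomial.coeff_zero]

/-- The powers of linear forms span all polynomials. -/
theorem MvPolynomial.eq_top_of_pow_linear_mem {d : ℕ} (W : Submodule ℝ (MvPolynomial (Fin d) ℝ))
    (h : ∀ (y : Fin d → ℝ) (n : ℕ), (∑ i, MvPolynomial.C (y i) * MvPolynomial.X i) ^ n ∈ W) :
    W = ⊤ := by
  rw [Submodule.eq_top_iff']
  -- The factor `ℓ ^ n` strengthens the induction: multiplying `p` by a variable is paid for by one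
  -- more power of a linear form.
  suffices ∀ (p : MvPolynomial (Fin d) ℝ) (y : Fin d → ℝ) (n : ℕ),
      p * (∑ i, MvPolynomial.C (y i) * MvPolynomial.X i) ^ n ∈ W by
    intro p
    simpa using this p 0 0
  intro p
  induction p using MvPolynomial.induction_on with
  | C a =>
    intro y n
    rw [← MvPolynomial.smul_eq_C_mul]
    exact W.smul_mem a (h y n)
  | add p q hp hq =>
    intro y n
    rw [add_mul]
    exact W.add_mem (hp y n) (hq y n)
  | mul_X p l ih =>
    intro y n
    set ℓ : MvPolynomial (Fin d) ℝ := ∑ i, MvPolynomial.C (y i) * MvPolynomial.X i with hℓ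
    have hlin : ∀ c : ℝ, ∑ i, MvPolynomial.C ((c • Pi.single l 1 + y : Fin d → ℝ) i) *
        MvPolynomial.X i = c • MvPolynomial.X l + ℓ := by
      intro c
      simp only [Pi.add_apply, Pi.smul_apply, map_add, add_mul, Finset.sum_add_distrib, hℓ,
        add_left_inj, smul_eq_mul]
      rw [Finset.sum_eq_single l (fun j _ hj => by simp [hj]) (by simp),
        MvPolynomial.smul_eq_C_mul]
      simp
    -- In `p * (c X_l + ℓ) ^ (n + 1)` the coefficient of `c` is `(n + 1) p X_l ℓ ^ n`; there are `n
    -- + 2` coefficients.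
    have hmem := W.coeff_mem_of_forall_sum_pow_smul_mem (n + 1 + 1)
      (fun i => p * (MvPolynomial.X l ^ i * ℓ ^ (n + 1 - i) * ((n + 1).choose i : MvPolynomial _ ℝ)))
      (fun c => by
        have := ih (c • Pi.single l 1 + y) (n + 1)
        rw [hlin, add_pow, Finset.mul_sum] at this
        convert this using 2
        rw [smul_pow, mul_assoc, mul_assoc, smul_mul_assoc, mul_smul_comm]) (i := 1) (by omega)
    have hsm := W.smul_mem ((n : ℝ) + 1)⁻¹ hmem
    convert hsm using 1
    have hn : ((n : ℝ) + 1) ≠ 0 := by positivity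
    rw [eq_inv_smul_iff₀ hn, MvPolynomial.smul_eq_C_mul]
    simp
    ring

/-! ### Polynomials and products of one-variable functions -/

theorem contDiff_mvPolynomial_eval {d : ℕ} (p : MvPolynomial (Fin d) ℝ) (n : WithTop ℕ∞) :
    ContDiff ℝ n fun x : Fin d → ℝ => MvPolynomial.eval x p := by
  induction p using MvPolynomial.induction_on with
  | C a => simpa using contDiff_const
  | add p q hp hq => simpa using hp.add hq
  | mul_X p i hp => simpa using hp.mul (contDiff_apply ℝ ℝ i)

/-- Polynomials as `C^r` functions. -/
noncomputable def mvPolynomialToContDiff (d r : ℕ) :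
    MvPolynomial (Fin d) ℝ →ₗ[ℝ] contDiffSubmodule d r where
  toFun p := ⟨fun x => MvPolynomial.eval x p, contDiff_mvPolynomial_eval p r⟩
  map_add' p q := by
    apply Subtype.ext
    funext x
    simp
  map_smul' c p := by
    apply Subtype.ext
    funext x
    simp

section Product

variable {d r : ℕ} {ι : Type*} (κ : ι → Fin d → ℕ) (hκ : ∀ i, ∑ j, κ i j ≤ r)
  (X : Set (Fin d → ℝ)) {σ : ℝ → ℝ} (hσ : ContDiff ℝ r σ)

/-- The `C^r` function `x ↦ ∏ j, ψ j (x j)`. -/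
def prodFun (r : ℕ) (ψ : Fin d → ℝ → ℝ) (hψ : ∀ j (n : ℕ), ContDiff ℝ n (ψ j)) :
    contDiffSubmodule d r :=
  ⟨fun x => ∏ j, ψ j (x j), contDiff_prod fun j _ => (hψ j r).comp (contDiff_apply ℝ ℝ j)⟩

theorem jet_prodFun (ψ : Fin d → ℝ → ℝ) (hψ : ∀ j (n : ℕ), ContDiff ℝ n (ψ j)) (i : ι) (x : X) :
    jet κ hκ X (prodFun r ψ hψ) i x =
      ∏ j, iteratedDeriv (κ i j) (ψ j) ((x : Fin d → ℝ) j) :=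
  congrFun (multiDeriv_prod hψ (κ i)) x

variable [Fintype ι] [CompactSpace X]

theorem jet_mvPolynomial_mem (hnp : ¬ ∃ p : Polynomial ℝ, ∀ t, σ t = p.eval t)
    (p : MvPolynomial (Fin d) ℝ) :
    jet κ hκ X (mvPolynomialToContDiff d r p) ∈ networkJets κ hκ X σ hσ := by
  have htop := MvPolynomial.eq_top_of_pow_linear_mem
    ((networkJets κ hκ X σ hσ).comap (jet κ hκ X ∘ₗ mvPolynomialToContDiff d r)) fun y n => by
      rw [Submodule.mem_comap, LinearMap.comp_apply]
      convert jet_ridge_pow_mem κ hκ X hσ hnp y n using 2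
      apply Subtype.ext
      funext x
      simp [mvPolynomialToContDiff, ridge, dotProduct]
  have hp : p ∈ (networkJets κ hκ X σ hσ).comap (jet κ hκ X ∘ₗ mvPolynomialToContDiff d r) := by
    rw [htop]
    exact Submodule.mem_top
  exact hp

/-- Evaluation at the `j`-th coordinate, composed with a continuous function, on `X`. -/
def coordComp (h : ℝ → ℝ) (hh : Continuous h) (j : Fin d) : C(X, ℝ) :=
  ⟨fun x => h ((x : Fin d → ℝ) j), hh.comp ((continuous_apply j).comp continuous_subtype_val)⟩

/-- One-variable polynomials approximate each factor with its derivatives up to order `r` on an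
interval containing the coordinates of `X`. Multiplication in `C(X, ℝ)` is continuous, so the jets
of the products converge. -/
theorem jet_prodFun_mem (hnp : ¬ ∃ p : Polynomial ℝ, ∀ t, σ t = p.eval t)
    (ψ : Fin d → ℝ → ℝ) (hψ : ∀ j (n : ℕ), ContDiff ℝ n (ψ j)) :
    jet κ hκ X (prodFun r ψ hψ) ∈ networkJets κ hκ X σ hσ := by
  obtain ⟨R, hR⟩ := (isCompact_iff_compactSpace.2 ‹CompactSpace X›).exists_bound_of_continuousOn
    (f := fun x : Fin d → ℝ => x) continuousOn_id
  choose p hp using fun (n : ℕ) (j : Fin d) =>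
    exists_polynomial_iteratedDeriv_near r R (hψ j r) (1 / ((n : ℝ) + 1)) (by positivity)
  have hpoly : ∀ n j (m : ℕ), ContDiff ℝ m fun t => (p n j).eval t := fun n j m =>
    contDiff_eval _ _
  have hmem : ∀ n, jet κ hκ X (prodFun r (fun j t => (p n j).eval t) (hpoly n)) ∈
      networkJets κ hκ X σ hσ := by
    intro n
    convert jet_mvPolynomial_mem κ hκ X hσ hnp
      (∏ j, Polynomial.aeval (MvPolynomial.X j) (p n j)) using 2
    apply Subtype.ext
    funext x
    simp only [prodFun, mvPolynomialToContDiff, LinearMap.coe_mk, AddHom.coe_mk, map_prod]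
    refine Finset.prod_congr rfl fun j _ => ?_
    rw [Polynomial.aeval_def, Polynomial.hom_eval₂, MvPolynomial.eval_X]
    have : (MvPolynomial.eval x).comp (algebraMap ℝ (MvPolynomial (Fin d) ℝ)) =
        RingHom.id ℝ := by
      ext
      simp
    rw [this, Polynomial.eval₂_id]
  have hlim : Tendsto (fun n => jet κ hκ X (prodFun r (fun j t => (p n j).eval t) (hpoly n)))
      atTop (𝓝 (jet κ hκ X (prodFun r ψ hψ))) := by
    rw [tendsto_pi_nhds]
    intro i
    have hform : ∀ (χ : Fin d → ℝ → ℝ) (hχ : ∀ j (n : ℕ), ContDiff ℝ n (χ j)),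
        jet κ hκ X (prodFun r χ hχ) i = ∏ j, coordComp X (iteratedDeriv (κ i j) (χ j))
          ((hχ j (κ i j)).continuous_iteratedDeriv _ le_rfl) j := by
      intro χ hχ
      ext x
      rw [jet_prodFun, ContinuousMap.prod_apply]
      rfl
    rw [hform]
    simp only [hform]
    refine tendsto_finsetProd _ fun j _ => ?_
    rw [tendsto_iff_norm_sub_tendsto_zero]
    refine squeeze_zero (fun _ => norm_nonneg _) (fun n => ?_)
      (tendsto_one_div_add_atTop_nhds_zero_nat (𝕜 := ℝ))
    rw [ContinuousMap.norm_le _ (by positivity)]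
    intro x
    have hxj : (x : Fin d → ℝ) j ∈ Set.Icc (-R) R :=
      abs_le.1 ((norm_le_pi_norm (x : Fin d → ℝ) j).trans (hR x x.2))
    rw [ContinuousMap.sub_apply, norm_sub_rev, Real.norm_eq_abs]
    exact (hp n j (κ i j) ((Finset.single_le_sum (fun _ _ => Nat.zero_le _)
      (Finset.mem_univ j)).trans (hκ i)) _ hxj).le
  exact (isClosed_networkJets κ hκ X hσ).mem_of_tendsto hlim (Eventually.of_forall hmem)

/-- Convolution of a continuous function with a product kernel. -/
theorem exists_mem_networkJets_eq_integral (hnp : ¬ ∃ p : Polynomial ℝ, ∀ t, σ t = p.eval t)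
    {ψ : ℝ → ℝ} (hψ : ∀ n : ℕ, ContDiff ℝ n ψ) {K : Set (Fin d → ℝ)} (hK : IsCompact K)
    {f : (Fin d → ℝ) → ℝ} (hf : ContinuousOn f K) :
    ∃ v ∈ networkJets κ hκ X σ hσ, ∀ i (x : X),
      v i x = ∫ t in K, f t * ∏ j, iteratedDeriv (κ i j) ψ ((x : Fin d → ℝ) j - t j) := by
  have hshift : ∀ (t : Fin d → ℝ) (j : Fin d) (n : ℕ), ContDiff ℝ n fun s => ψ (s - t j) :=
    fun t j n => (hψ n).comp (contDiff_id.sub contDiff_const)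
  set F : (Fin d → ℝ) → ι → C(X, ℝ) := fun t =>
    f t • jet κ hκ X (prodFun r (fun j s => ψ (s - t j)) (hshift t)) with hF
  have hval : ∀ t i (x : X), jet κ hκ X (prodFun r (fun j s => ψ (s - t j)) (hshift t)) i x =
      ∏ j, iteratedDeriv (κ i j) ψ ((x : Fin d → ℝ) j - t j) := by
    intro t i x
    rw [jet_prodFun]
    refine Finset.prod_congr rfl fun j _ => ?_
    rw [iteratedDeriv_comp_sub_const]
  have hcont : ContinuousOn F K := by
    refine hf.smul (Continuous.continuousOn (continuous_pi fun i => ?_))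
    refine ContinuousMap.continuous_of_continuous_uncurry _ ?_
    have : (Function.uncurry fun (t : Fin d → ℝ) (x : X) =>
        jet κ hκ X (prodFun r (fun j s => ψ (s - t j)) (hshift t)) i x) =
        fun p : (Fin d → ℝ) × X =>
          ∏ j, iteratedDeriv (κ i j) ψ ((p.2 : Fin d → ℝ) j - p.1 j) := by
      funext p
      exact hval p.1 i p.2
    rw [this]
    refine continuous_finsetProd _ fun j _ =>
      ((hψ (κ i j)).continuous_iteratedDeriv _ le_rfl).comp (Continuous.sub ?_ ?_)
    · exact (continuous_apply j).comp (continuous_subtype_val.comp continuous_snd)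
    · exact (continuous_apply j).comp continuous_fst
  have hint : Integrable F (volume.restrict K) := hcont.integrableOn_compact hK
  refine ⟨∫ t in K, F t, (networkJets κ hκ X σ hσ).integral_mem_of_isClosed
    (isClosed_networkJets κ hκ X hσ) hint fun t => Submodule.smul_mem _ _
      (jet_prodFun_mem κ hκ X hσ hnp _ _), fun i x => ?_⟩
  rw [integral_apply_apply hint]
  simp only [hF, Pi.smul_apply, ContinuousMap.smul_apply, smul_eq_mul, hval]

end Product

/-! ### Mollification of the target function -/

theorem iteratedDeriv_eq_zero_of_notMem_tsupport {ψ : ℝ → ℝ} {s : ℝ} (hs : s ∉ tsupport ψ)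
    (n : ℕ) : iteratedDeriv n ψ s = 0 := by
  have h : ψ =ᶠ[𝓝 s] fun _ => 0 := notMem_tsupport_iff_eventuallyEq.1 hs
  rw [h.iteratedDeriv_eq, iteratedDeriv_const]
  simp

theorem integrable_mul_of_eq_zero_off_compact {d : ℕ} {K : Set (Fin d → ℝ)} (hK : IsCompact K)
    {h w : (Fin d → ℝ) → ℝ} (hh : ContinuousOn h K) (hw : Continuous w)
    (hwK : ∀ t ∉ K, w t = 0) : Integrable fun t => h t * w t := by
  rw [← integrableOn_iff_integrable_of_support_subset (s := K)]
  · exact (hh.mul hw.continuousOn).integrableOn_compact hK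
  · intro t ht
    by_contra hcon
    exact ht (by simp [hwK t hcon])

/-- Integration by parts for the multi-index derivatives of `f` against a product kernel. -/
theorem integral_multiDeriv_mul_prod {d : ℕ} {m : Fin d → ℕ} {U K : Set (Fin d → ℝ)}
    {f : (Fin d → ℝ) → ℝ} (hf : IsCmOn m U f) (hK : IsCompact K) (hKU : K ⊆ U) {ψ : ℝ → ℝ}
    (hψ : ∀ n : ℕ, ContDiff ℝ n ψ) (x : Fin d → ℝ)
    (hx : ∀ t ∉ K, ∀ l : Fin d → ℕ, ∏ j, iteratedDeriv (l j) ψ (x j - t j) = 0)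
    (k : Fin d → ℕ) : k ≤ m → ∀ l : Fin d → ℕ,
      ∫ t, multiDeriv k f t * ∏ j, iteratedDeriv (l j) ψ (x j - t j) =
        ∫ t, f t * ∏ j, iteratedDeriv ((l + k : Fin d → ℕ) j) ψ (x j - t j) := by
  set w : (Fin d → ℕ) → (Fin d → ℝ) → ℝ := fun l t => ∏ j, iteratedDeriv (l j) ψ (x j - t j)
    with hw
  have hwc : ∀ l, Continuous (w l) := fun l => continuous_finsetProd _ fun j _ =>
    ((hψ (l j)).continuous_iteratedDeriv _ le_rfl).comp
      (continuous_const.sub (continuous_apply j))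
  have hw0 : ∀ l, ∀ t ∉ K, w l t = 0 := fun l t ht => hx t ht l
  have hwK : ∀ l, tsupport (w l) ⊆ K := fun l => closure_minimal (fun t ht => by
    by_contra hcon
    exact ht (hw0 l t hcon)) hK.isClosed
  -- The minus sign comes from `w` being a function of `x - t`; it cancels the sign of integration
  -- by parts.
  have hwd : ∀ l i t, HasLineDerivAt ℝ (w l) (-w (l + Pi.single i 1) t) t (Pi.single i 1) := by
    intro l i t
    have h := hasLineDerivAt_prod_iteratedDeriv (ψ := fun _ => ψ) (fun _ => hψ) l (x - t) i
    unfold HasLineDerivAt at h ⊢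
    have h' := HasDerivAt.comp_const_sub (0 : ℝ) 0 (by rwa [sub_zero])
    refine h'.congr_of_eventuallyEq (Eventually.of_forall fun s => ?_)
    refine Finset.prod_congr rfl fun j _ => ?_
    simp only [Pi.add_apply, Pi.sub_apply, Pi.smul_apply, smul_eq_mul]
    congr 1
    ring
  induction k using multiIndex_induction with
  | zero =>
    intro _ l
    simp [multiDeriv_zero]
  | step k i hki ih =>
    intro hk l
    have hkm : k ≤ m := le_self_add.trans hk
    have hlt : k i < m i := by
      have := hk i
      simp at this
      omega
    have hd : ∀ t ∈ U, HasLineDerivAt ℝ (multiDeriv k f) (multiDeriv (k + Pi.single i 1) f t) t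
        (Pi.single i 1) := by
      intro t ht
      rw [multiDeriv_add_single k i hki]
      exact (hf.exists_deriv k hkm i hlt hki t ht).hasLineDerivAt
    have hc : ContinuousOn (multiDeriv k f) K := (hf.continuousOn k hkm).mono hKU
    have hc' : ContinuousOn (multiDeriv (k + Pi.single i 1) f) K :=
      (hf.continuousOn _ hk).mono hKU
    -- `multiDeriv k f` has to be differentiable only on the support of `w l`, inside `U`; its
    -- behaviour elsewhere is irrelevant.
    have hparts := integral_bilinear_hasLineDerivAt_right_eq_neg_left_of_integrable
      (μ := volume) (B := ContinuousLinearMap.mul ℝ ℝ) (f := multiDeriv k f)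
      (f' := multiDeriv (k + Pi.single i 1) f) (g := w l) (g' := fun t => -w (l + Pi.single i 1) t)
      (v := Pi.single i 1)
      (integrable_mul_of_eq_zero_off_compact hK hc' (hwc l) (hw0 l))
      (integrable_mul_of_eq_zero_off_compact hK hc (hwc _).neg
        fun t ht => by rw [hw0 _ t ht, neg_zero])
      (integrable_mul_of_eq_zero_off_compact hK hc (hwc l) (hw0 l))
      (fun t ht => hd t (hKU (hwK l ht))) (fun t _ => hwd l i t)
    simp only [ContinuousLinearMap.mul_apply', mul_neg, integral_neg, neg_inj] at hparts
    have := ih hkm (l + Pi.single i 1)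
    rw [add_assoc, add_comm (Pi.single i 1)] at this
    rw [← this]
    exact hparts.symm

/-- A smooth approximation of the identity on the line. -/
theorem exists_smooth_kernel {δ : ℝ} (hδ : 0 < δ) : ∃ ψ : ℝ → ℝ, (∀ n : ℕ, ContDiff ℝ n ψ) ∧
    (∀ s, 0 ≤ ψ s) ∧ ∫ s, ψ s = 1 ∧ ∀ s, δ < |s| → ∀ n, iteratedDeriv n ψ s = 0 := by
  let b : ContDiffBump (0 : ℝ) :=
    { rIn := δ / 2
      rOut := δ
      rIn_pos := by positivity
      rIn_lt_rOut := half_lt_self hδ }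
  refine ⟨b.normed volume, fun n => b.contDiff_normed, b.nonneg_normed, b.integral_normed,
    fun s hs n => iteratedDeriv_eq_zero_of_notMem_tsupport ?_ n⟩
  rw [b.tsupport_normed_eq]
  simpa using hs

/-- The element `v` comes from mollifying `f` with a product kernel of width `δ`. By parts, `v i x`
is an average of `D^k f`, with `k = κ i`, over points within `δ` of `x`. -/
theorem exists_mem_networkJets_near {d r : ℕ} {ι : Type*} [Fintype ι] (κ : ι → Fin d → ℕ)
    (hκ : ∀ i, ∑ j, κ i j ≤ r) {X U : Set (Fin d → ℝ)} (hX : IsCompact X) (hU : IsOpen U)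
    (hXU : X ⊆ U) [CompactSpace X] {σ : ℝ → ℝ} (hσ : ContDiff ℝ r σ)
    (hnp : ¬ ∃ p : Polynomial ℝ, ∀ t, σ t = p.eval t) {f : (Fin d → ℝ) → ℝ}
    (hfc : ContinuousOn f U) (hf : ∀ i, ∃ m, κ i ≤ m ∧ IsCmOn m U f) {ε : ℝ} (hε : 0 < ε) :
    ∃ v ∈ networkJets κ hκ X σ hσ, ∀ i (x : X), |v i x - multiDeriv (κ i) f x| ≤ ε := by
  choose m hkm hm using hf
  have hunif : ∃ δ > 0, ∀ i, ∀ x ∈ X, ∀ t, dist x t < δ →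
      |multiDeriv (κ i) f t - multiDeriv (κ i) f x| ≤ ε := by
    have h := fun i => hX.uniformContinuousAt_of_continuousAt (multiDeriv (κ i) f)
      (fun x hx => ((hm i).continuousOn (κ i) (hkm i)).continuousAt (hU.mem_nhds (hXU hx)))
      (Metric.dist_mem_uniformity hε)
    obtain ⟨δ, hδ, hsub⟩ := Metric.mem_uniformity_dist.1 (Filter.iInter_mem.2 h)
    refine ⟨δ, hδ, fun i x hx t hxt => ?_⟩
    have := Set.mem_iInter.1 (hsub hxt) i hx
    rw [abs_sub_comm]
    exact le_of_lt this
  obtain ⟨δ₁, hδ₁, hnear⟩ := hunif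
  obtain ⟨δ₂, hδ₂, hthick⟩ := hX.exists_cthickening_subset_open hU hXU
  -- Halving makes `dist ≤ δ` imply `dist < δ₁`; the bound by `δ₂` keeps the thickening of `X`
  -- inside `U`.
  set δ := min (δ₁ / 2) δ₂ with hδdef
  have hδ : 0 < δ := lt_min (by positivity) hδ₂
  have hδ1 : δ < δ₁ := (min_le_left _ _).trans_lt (half_lt_self hδ₁)
  set K := Metric.cthickening δ X with hKdef
  have hK : IsCompact K := hX.cthickening
  have hKU : K ⊆ U := (Metric.cthickening_mono (min_le_right _ _) X).trans hthick
  obtain ⟨ψ, hψ, hψ0, hψ1, hψs⟩ := exists_smooth_kernel hδ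
  -- The distance is the sup distance, so its balls are cubes, as are the supports of product
  -- kernels.
  have hfar : ∀ x t : Fin d → ℝ, ¬ dist t x ≤ δ → ∀ l : Fin d → ℕ,
      ∏ j, iteratedDeriv (l j) ψ (x j - t j) = 0 := by
    intro x t hxt l
    rw [dist_pi_le_iff hδ.le] at hxt
    push Not at hxt
    obtain ⟨j, hj⟩ := hxt
    refine Finset.prod_eq_zero (Finset.mem_univ j) (hψs _ ?_ _)
    rwa [Real.dist_eq, abs_sub_comm] at hj
  have hoff : ∀ x ∈ X, ∀ t ∉ K, ∀ l : Fin d → ℕ,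
      ∏ j, iteratedDeriv (l j) ψ (x j - t j) = 0 := fun x hx t ht =>
    hfar x t fun h => ht (Metric.mem_cthickening_of_dist_le t x δ X hx h)
  obtain ⟨v, hv, hvint⟩ := exists_mem_networkJets_eq_integral κ hκ X hσ hnp hψ hK (hfc.mono hKU)
  refine ⟨v, hv, fun i x => ?_⟩
  set w : (Fin d → ℝ) → ℝ := fun t => ∏ j, ψ ((x : Fin d → ℝ) j - t j) with hw
  have hwc : Continuous w := continuous_finsetProd _ fun j _ =>
    (hψ 0).continuous.comp (continuous_const.sub (continuous_apply j))
  have hw0 : ∀ t, 0 ≤ w t := fun t => Finset.prod_nonneg fun j _ => hψ0 _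
  have hwK : ∀ t ∉ K, w t = 0 := fun t ht => by simpa using hoff x x.2 t ht 0
  have hw1 : ∫ t, w t = 1 := by
    have h := integral_sub_left_eq_self (fun t : Fin d → ℝ => ∏ j, ψ (t j)) volume
      (x : Fin d → ℝ)
    rw [integral_fintype_prod_volume_eq_prod (fun _ => ψ), hψ1, Finset.prod_const_one] at h
    exact h
  have hwi : Integrable w := by
    simpa using integrable_mul_of_eq_zero_off_compact hK
      (continuousOn_const (c := (1 : ℝ))) hwc hwK
  have hDw : Integrable fun t => multiDeriv (κ i) f t * w t :=
    integrable_mul_of_eq_zero_off_compact hK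
      (((hm i).continuousOn (κ i) (hkm i)).mono hKU) hwc hwK
  have hv1 : v i x = ∫ t, multiDeriv (κ i) f t * w t := by
    have hparts := integral_multiDeriv_mul_prod (hm i) hK hKU hψ x (hoff x x.2) (κ i) (hkm i) 0
    simp only [Pi.zero_apply, iteratedDeriv_zero, zero_add] at hparts
    rw [hvint, hparts]
    exact setIntegral_eq_integral_of_forall_compl_eq_zero fun t ht => by
      rw [hoff x x.2 t ht (κ i), mul_zero]
  have hdiff : v i x - multiDeriv (κ i) f x =
      ∫ t, (multiDeriv (κ i) f t - multiDeriv (κ i) f x) * w t := by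
    simp only [sub_mul]
    rw [integral_sub hDw (hwi.const_mul _), integral_const_mul, hw1, hv1, mul_one]
  rw [hdiff, ← Real.norm_eq_abs]
  refine (norm_integral_le_of_norm_le (hwi.const_mul ε) (Eventually.of_forall fun t => ?_)).trans
    (by rw [integral_const_mul, hw1, mul_one])
  rw [norm_mul, Real.norm_eq_abs, Real.norm_eq_abs, abs_of_nonneg (hw0 t)]
  by_cases ht : dist t (x : Fin d → ℝ) ≤ δ
  · exact mul_le_mul_of_nonneg_right
      (hnear i x x.2 t (by rw [dist_comm]; exact ht.trans_lt hδ1)) (hw0 t)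
  · have : w t = 0 := by simpa using hfar x t ht 0
    simp [this]

/-! ### From the closed span to networks, and nonnegativity -/

theorem contDiff_network {d r N : ℕ} {σ : ℝ → ℝ} (hσ : ContDiff ℝ r σ) (a θ : Fin N → ℝ)
    (y : Fin N → Fin d → ℝ) : ContDiff ℝ r (network σ a θ y) :=
  ContDiff.sum fun j _ => contDiff_const.mul (contDiff_ridge hσ (y j) (θ j))

/-- Elements of `networkJets` are approximated by the jets of networks. -/
theorem exists_network_near_of_mem_networkJets {d r : ℕ} {ι : Type*} [Fintype ι]
    (κ : ι → Fin d → ℕ) (hκ : ∀ i, ∑ j, κ i j ≤ r) (X : Set (Fin d → ℝ)) [CompactSpace X]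
    {σ : ℝ → ℝ} (hσ : ContDiff ℝ r σ) {v : ι → C(X, ℝ)} (hv : v ∈ networkJets κ hκ X σ hσ)
    {ε : ℝ} (hε : 0 < ε) :
    ∃ (N : ℕ) (a θ : Fin N → ℝ) (y : Fin N → Fin d → ℝ), ∀ i (x : X),
      |v i x - multiDeriv (κ i) (network σ a θ y) x| < ε := by
  obtain ⟨w, hw, hvw⟩ := Metric.mem_closure_iff.1 hv ε hε
  obtain ⟨N, a, g, rfl⟩ := Submodule.mem_span_set'.1 hw
  choose p hp using fun j => (g j).2
  refine ⟨N, a, fun j => (p j).2, fun j => (p j).1, fun i x => ?_⟩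
  have hjet : ∑ j, a j • (g j : ι → C(X, ℝ)) =
      jet κ hκ X ⟨network σ a (fun j => (p j).2) fun j => (p j).1, contDiff_network hσ _ _ _⟩ := by
    simp only [← hp, ← map_smul, ← map_sum]
    congr 1
    apply Subtype.ext
    funext x
    simp [ridge, network]
  rw [hjet, dist_eq_norm] at hvw
  have h1 := (ContinuousMap.norm_coe_le_norm _ x).trans_lt ((norm_le_pi_norm _ i).trans_lt hvw)
  exact h1

/-- Approximation of `f + c` by networks. -/
theorem exists_network_near {d r : ℕ} {ι : Type*} [Fintype ι] (κ : ι → Fin d → ℕ)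
    (hκ : ∀ i, ∑ j, κ i j ≤ r) {X U : Set (Fin d → ℝ)} (hX : IsCompact X) (hU : IsOpen U)
    (hXU : X ⊆ U) {σ : ℝ → ℝ} (hσ : ContDiff ℝ r σ)
    (hnp : ¬ ∃ p : Polynomial ℝ, ∀ t, σ t = p.eval t) {f : (Fin d → ℝ) → ℝ}
    (hfc : ContinuousOn f U) (hf : ∀ i, ∃ m, κ i ≤ m ∧ IsCmOn m U f) (c : ℝ) {ε : ℝ}
    (hε : 0 < ε) :
    ∃ (N : ℕ) (a θ : Fin N → ℝ) (y : Fin N → Fin d → ℝ), ∀ i, ∀ x ∈ X,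
      |multiDeriv (κ i) f x + (if κ i = 0 then c else 0) -
        multiDeriv (κ i) (network σ a θ y) x| < ε := by
  have : CompactSpace X := isCompact_iff_compactSpace.1 hX
  obtain ⟨v, hv, hvf⟩ := exists_mem_networkJets_near κ hκ hX hU hXU hσ hnp hfc hf
    (ε := ε / 2) (half_pos hε)
  have hconst : jet κ hκ X (mvPolynomialToContDiff d r (MvPolynomial.C c)) ∈
      networkJets κ hκ X σ hσ := jet_mvPolynomial_mem κ hκ X hσ hnp _
  have hval : ∀ i (x : X), jet κ hκ X (mvPolynomialToContDiff d r (MvPolynomial.C c)) i x =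
      if κ i = 0 then c else 0 := by
    intro i x
    -- A constant is a ridge function with direction `0`, so the product of powers kills every
    -- derivative with `κ i ≠ 0`.
    have h := multiDeriv_ridge (ρ := fun _ => c) (d := d) (contDiff_const (n := r)) 0 0 (κ i)
      (hκ i)
    have h2 : jet κ hκ X (mvPolynomialToContDiff d r (MvPolynomial.C c)) i x =
        multiDeriv (κ i) (fun _ => c) x := by
      simp [jet, mvPolynomialToContDiff]
    rw [h2, h]
    by_cases h0 : κ i = 0
    · simp [h0]
    · obtain ⟨j, hj⟩ := Function.ne_iff.1 h0
      simp only [h0, if_false]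
      rw [Finset.prod_eq_zero (Finset.mem_univ j) (by simpa using hj), zero_mul]
  obtain ⟨N, a, θ, y, hnet⟩ := exists_network_near_of_mem_networkJets κ hκ X hσ
    (Submodule.add_mem _ hv hconst) (half_pos hε)
  refine ⟨N, a, θ, y, fun i x hx => ?_⟩
  have h1 := hvf i ⟨x, hx⟩
  have h2 := hnet i ⟨x, hx⟩
  rw [Pi.add_apply, ContinuousMap.add_apply, hval] at h2
  rw [abs_le] at h1
  rw [abs_lt] at h2 ⊢
  constructor <;> linarith [h1.1, h1.2, h2.1, h2.2]

theorem mainTheorem5 {d q : ℕ} (X : Set (Fin d → ℝ)) (hX : IsCompact X)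
    (m : Fin q → Fin d → ℕ) (f : (Fin d → ℝ) → ℝ)
    (hf : ∀ i, IsCHat (m i) X f) (hf_nonneg : ∀ x ∈ X, 0 ≤ f x)
    (σ : ℝ → ℝ)
    (hσ : ContDiff ℝ ((Finset.univ.sup fun i : Fin q => ∑ j, m i j : ℕ) : WithTop ℕ∞) σ)
    (hσ_nonpoly : ¬ ∃ p : Polynomial ℝ, ∀ t, σ t = p.eval t)
    (ε : ℝ) (hε : 0 < ε) :
    ∃ (N : ℕ) (a θ : Fin N → ℝ) (y : Fin N → Fin d → ℝ),
      (∀ x ∈ X, 0 ≤ network σ a θ y x) ∧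
      ∀ k : Fin d → ℕ, (∃ i, k ≤ m i) →
        supNormOn X (fun x => multiDeriv k f x - multiDeriv k (network σ a θ y) x)
          < ENNReal.ofReal ε := by
  rcases isEmpty_or_nonempty (Fin q) with hq | ⟨⟨i₀⟩⟩
  -- With no `m i` there is nothing to approximate, and the empty network is `0`.
  · exact ⟨0, 0, 0, 0, fun x _ => by simp [network], fun k ⟨i, _⟩ => (hq.false i).elim⟩
  choose U hU hXU hfU using hf
  have hmono : ∀ i, IsCmOn (m i) (⋂ i, U i) f := fun i =>
    { exists_deriv := fun k hk j hj hkj x hx =>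
        (hfU i).exists_deriv k hk j hj hkj x (Set.mem_iInter.1 hx i)
      continuousOn := fun k hk => ((hfU i).continuousOn k hk).mono (Set.iInter_subset _ i) }
  set S : Finset (Fin d → ℕ) := Finset.univ.biUnion fun i => Finset.Iic (m i) with hS
  have hmemS : ∀ k, k ∈ S ↔ ∃ i, k ≤ m i := fun k => by simp [hS]
  have hfc : ContinuousOn f (⋂ i, U i) := by
    simpa [multiDeriv_zero] using (hmono i₀).continuousOn 0 (zero_le)
  -- Shift and tolerance are both `ε / 3`: the network then exceeds `f` on `X`, and every derivative
  -- error stays below `2 * ε / 3`.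
  obtain ⟨N, a, θ, y, hnet⟩ := exists_network_near (ι := S) (fun k => (k : Fin d → ℕ))
    (fun k => by
      obtain ⟨i, hi⟩ := (hmemS k).1 k.2
      exact (Finset.sum_le_sum fun j _ => hi j).trans
        (Finset.le_sup (f := fun i : Fin q => ∑ j, m i j) (Finset.mem_univ i)))
    hX (isOpen_iInter_of_finite hU) (Set.subset_iInter hXU) hσ hσ_nonpoly hfc
    (fun k => by
      obtain ⟨i, hi⟩ := (hmemS k).1 k.2
      exact ⟨m i, hi, hmono i⟩) (ε / 3) (ε := ε / 3) (by positivity)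
  refine ⟨N, a, θ, y, fun x hx => ?_, fun k hk => ?_⟩
  · have h := hnet ⟨0, (hmemS 0).2 ⟨i₀, zero_le⟩⟩ x hx
    simp only [multiDeriv_zero, if_true] at h
    have := (abs_lt.1 h).2
    linarith [hf_nonneg x hx]
  -- A supremum of strict bounds is only a weak bound; the slack between `2 * ε / 3` and `ε`
  -- restores strictness.
  · refine lt_of_le_of_lt (b := ENNReal.ofReal (2 * ε / 3)) (iSup₂_le fun x hx => ?_)
      ((ENNReal.ofReal_lt_ofReal_iff hε).2 (by linarith))
    rw [Real.enorm_eq_ofReal_abs]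
    refine ENNReal.ofReal_le_ofReal ?_
    have h := abs_lt.1 (hnet ⟨k, (hmemS k).2 hk⟩ x hx)
    have hc : 0 ≤ (if k = 0 then ε / 3 else 0) ∧ (if k = 0 then ε / 3 else 0) ≤ ε / 3 := by
      split_ifs <;> constructor <;> linarith
    simp only at h
    rw [abs_le]
    constructor <;> linarith [h.1, h.2, hc.1, hc.2]
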